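/- A left brace is a set $B$ with operations $+$ and $\cdot$ such that $(B,+)$ is an abelian group, $(B,\cdot)$ is a group, and $a(b+c)+a=ab+ac$ for all $a,b,c\in B$. A left ideal of $B$ is a subgroup $L$ of $(B,+)$ with $ba-b\in L$ for all $b\in B$, $a\in L$; an ideal is a left ideal that is also a normal subgroup of $(B,\cdot)$. A left brace is simple if it is nonzero and its only ideals are $0$ and $B$. Theorem. For a positive integer $k$ let $\nu(k)=1$ if $k$ is even and $\nu(k)=2$ if $k$ is odd. Let $n>1$ be an integer. For $z\in\mathbb{Z}/(n)$ let $p_z$ be a prime number, with $p_z\neq p_{z'}$ for $z\neq z'$. Let $k_z$ be the order of $p_z$ in $(\mathbb{Z}/(p_{z-1}))^*$ (indices modulo $n$). Let $$l_z=\begin{cases}\max\{\nu(k_z)k_z,\ \nu(k_{z-1})k_{z-1}\}\,(\nu(k_z)k_z+1) & \text{if } p_{z-1}\neq 2,\\ 2\,\nu(k_{z-1})k_{z-1} & \text{if } p_{z-1}=2.\end{cases}$$ Then for all integers $m_z\geq l_z$ ($z\in\mathbb{Z}/(n)$) there exists a simple left brace of order $\prod_{z\in\mathbb{Z}/(n)}p_z^{m_z}$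 whose multiplicative group is metabelian (its commutator subgroup is abelian) and has all Sylow subgroups abelian. -/

import Mathlib

/-- A left brace: a type with an abelian group structure `(B, +)` and a group structure
`(B, *)` such that `a * (b + c) + a = a * b + a * c`. -/
class LeftBrace (B : Type*) extends AddCommGroup B, Group B where
  mul_add_add : ∀ a b c : B, a * (b + c) + a = a * b + a * c

namespace LeftBrace

/-- The lambda map `λ_a(b) = ab - a`. -/
def lam {B : Type*} [LeftBrace B] (a b : B) : B := a * b - a

/-- A left ideal is a subgroup of the additive group that is stable under all `λ_b`. -/
def IsLeftIdeal {B : Type*} [LeftBrace B] (L : AddSubgroup B) : Prop :=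
  ∀ b : B, ∀ a ∈ L, lam b a ∈ L

/-- An ideal is a left ideal that is a normal subgroup of the multiplicative group. -/
def IsIdeal {B : Type*} [LeftBrace B] (I : AddSubgroup B) : Prop :=
  IsLeftIdeal I ∧ ∃ N : Subgroup B, N.Normal ∧ (N : Set B) = (I : Set B)

/-- A left brace is simple if it is nonzero and its only ideals are `0` and itself. -/
def IsSimple (B : Type*) [LeftBrace B] : Prop :=
  Nontrivial B ∧ ∀ I : AddSubgroup B, IsIdeal I → I = ⊥ ∨ I = ⊤

end LeftBrace

/-- A group is metabelian if its commutator subgroup is abelian. -/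
def IsMetabelianGroup (G : Type*) [Group G] : Prop :=
  ∀ x ∈ commutator G, ∀ y ∈ commutator G, x * y = y * x

/-- All Sylow subgroups (for all primes) are abelian. -/
def HasAbelianSylows (G : Type*) [Group G] : Prop :=
  ∀ q : ℕ, q.Prime → ∀ P : Sylow q G, ∀ x ∈ P, ∀ y ∈ P, x * y = y * x

/-- `ν(k)` is `1` for even `k` and `2` for odd `k`. -/
def braceNu (k : ℕ) : ℕ := if Even k then 1 else 2

/-- `k_z` is the multiplicative order of `p_z` modulo `p_{z-1}`, indices in `ℤ/n`. (For
distinct primes `p_z` is a unit modulo `p_{z-1}`, and the order as an element of the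
multiplicative monoid is the order in the unit group.) -/
noncomputable def braceOrd {n : ℕ} (p : ZMod n → ℕ) (z : ZMod n) : ℕ :=
  orderOf (p z : ZMod (p (z - 1)))

/-- The lower bound `l_z`. -/
noncomputable def braceBound {n : ℕ} (p : ZMod n → ℕ) (z : ZMod n) : ℕ :=
  if p (z - 1) = 2 then
    2 * (braceNu (braceOrd p (z - 1)) * braceOrd p (z - 1))
  else
    max (braceNu (braceOrd p z) * braceOrd p z)
        (braceNu (braceOrd p (z - 1)) * braceOrd p (z - 1)) *
      (braceNu (braceOrd p z) * braceOrd p z + 1)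

/-! Put the required structure on `V × W` with `W = ⊕ W_z`, `W_z = F_{p_z}^{s_z}`, and `V = ⊕
E_z^{r_z}`, where `|E_z| = p_z^{d_z}` and `m_z = d_z r_z + s_z`. Multiplicatively this is `V ⋊ W`
with both factors abelian, hence metabelian; additively `V` is extended by `W` through a form. Only
`W_{z-1}` acts on `E_z`, while the form of `E_z` takes values in `W_z`, so the `p_z`-parts of `V`
and `W` commute and Sylow subgroups are abelian.

Simplicity comes from a cycle. A nonzero ideal contains some `(0, w)` with `w ≠ 0`, by nondegeneracy
(`form_mem_sndPart`). Commutators with it give whole blocks on which `w` acts nontrivially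
(`act_sub_mem`), the form on a block gives a vector of the next `W_z`, and this vector acts on the
blocks after it. The star-shaped functionals and vectors make all blocks reachable
(`cycleDatum_isSimple`).

The blocks live on finite fields (`exists_isometryBlock`). The bound `l_z` provides `s_z ≤ r_z`, so
that the form values span `W_z`, and `s_{z-1} ≤ r_z`, so that the functionals separate `W_{z-1}`. -/

/-- The data of an asymmetric product: an action of `W` on `V` by automorphisms and a
symmetric biadditive form on `V` with values in `W` that is invariant under the action. -/
structure AsymmetricDatum (V W : Type*) [AddCommGroup V] [AddCommGroup W] where
  act : W → V →+ V
  act_zero : ∀ v, act 0 v = v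
  act_add : ∀ w w' v, act (w + w') v = act w (act w' v)
  form : V →+ V →+ W
  form_comm : ∀ v v', form v v' = form v' v
  form_act : ∀ w v v', form (act w v) (act w v') = form v v'

/-- The asymmetric product: the semidirect product of `W` acting on `V` as multiplicative
group, and the extension of `V` by `W` with cocycle `form` as additive group. -/
@[ext] structure AsymmetricProduct {V W : Type*} [AddCommGroup V] [AddCommGroup W]
    (D : AsymmetricDatum V W) where
  fst : V
  snd : W

/-! ### Asymmetric products as left braces, and their ideals -/

namespace AsymmetricProduct

open LeftBrace

variable {V W : Type*} [AddCommGroup V] [AddCommGroup W] {D : AsymmetricDatum V W}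

instance : Add (AsymmetricProduct D) := ⟨fun a b => ⟨a.fst + b.fst, a.snd + b.snd + D.form a.fst b.fst⟩⟩
instance : Zero (AsymmetricProduct D) := ⟨⟨0, 0⟩⟩
instance : Neg (AsymmetricProduct D) := ⟨fun a => ⟨-a.fst, -a.snd + D.form a.fst a.fst⟩⟩
instance : Mul (AsymmetricProduct D) := ⟨fun a b => ⟨a.fst + D.act a.snd b.fst, a.snd + b.snd⟩⟩
instance : One (AsymmetricProduct D) := ⟨⟨0, 0⟩⟩
instance : Inv (AsymmetricProduct D) := ⟨fun a => ⟨-D.act (-a.snd) a.fst, -a.snd⟩⟩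

@[simp] theorem fst_add (a b : AsymmetricProduct D) : (a + b).fst = a.fst + b.fst := rfl
@[simp] theorem snd_add (a b : AsymmetricProduct D) :
    (a + b).snd = a.snd + b.snd + D.form a.fst b.fst := rfl
@[simp] theorem fst_zero : (0 : AsymmetricProduct D).fst = 0 := rfl
@[simp] theorem snd_zero : (0 : AsymmetricProduct D).snd = 0 := rfl
@[simp] theorem fst_neg (a : AsymmetricProduct D) : (-a).fst = -a.fst := rfl
@[simp] theorem snd_neg (a : AsymmetricProduct D) :
    (-a).snd = -a.snd + D.form a.fst a.fst := rfl
@[simp] theorem fst_mul (a b : AsymmetricProduct D) :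
    (a * b).fst = a.fst + D.act a.snd b.fst := rfl
@[simp] theorem snd_mul (a b : AsymmetricProduct D) : (a * b).snd = a.snd + b.snd := rfl
@[simp] theorem fst_one : (1 : AsymmetricProduct D).fst = 0 := rfl
@[simp] theorem snd_one : (1 : AsymmetricProduct D).snd = 0 := rfl
@[simp] theorem fst_inv (a : AsymmetricProduct D) : (a⁻¹).fst = -D.act (-a.snd) a.fst := rfl
@[simp] theorem snd_inv (a : AsymmetricProduct D) : (a⁻¹).snd = -a.snd := rfl

instance : AddCommGroup (AsymmetricProduct D) where
  add_assoc a b c := by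
    ext
    · simp [add_assoc]
    · simp only [snd_add, fst_add, map_add, AddMonoidHom.add_apply]; abel
  zero_add a := by ext <;> simp
  add_zero a := by ext <;> simp
  nsmul := nsmulRec
  zsmul := zsmulRec
  neg_add_cancel a := by ext <;> simp
  add_comm a b := by
    ext
    · simp [add_comm]
    · simp [D.form_comm a.fst, add_comm]

instance : Group (AsymmetricProduct D) where
  mul_assoc a b c := by ext <;> simp [D.act_add, add_assoc]
  one_mul a := by ext <;> simp [D.act_zero]
  mul_one a := by ext <;> simp
  inv_mul_cancel a := by ext <;> simp

instance : LeftBrace (AsymmetricProduct D) where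
  mul_add_add a b c := by
    ext
    · simp; abel
    · simp only [snd_add, snd_mul, fst_mul, fst_add, map_add, AddMonoidHom.add_apply, D.form_act,
        D.form_comm a.fst (D.act a.snd c.fst)]
      abel

/-- The projection of the multiplicative group onto `W`. -/
def sndHom (D : AsymmetricDatum V W) : AsymmetricProduct D →* Multiplicative W where
  toFun a := Multiplicative.ofAdd a.snd
  map_one' := rfl
  map_mul' _ _ := rfl

theorem snd_pow (a : AsymmetricProduct D) (k : ℕ) : (a ^ k).snd = k • a.snd := by
  induction k with
  | zero => simp
  | succ k ih => simp [pow_succ, ih, succ_nsmul]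

theorem fst_pow_of_snd_eq_zero {a : AsymmetricProduct D} (ha : a.snd = 0) (k : ℕ) :
    (a ^ k).fst = k • a.fst := by
  induction k with
  | zero => simp
  | succ k ih => simp [pow_succ, ih, succ_nsmul, snd_pow, ha, D.act_zero]

theorem isMetabelianGroup (D : AsymmetricDatum V W) :
    IsMetabelianGroup (AsymmetricProduct D) := by
  have key : ∀ x ∈ commutator (AsymmetricProduct D), x.snd = 0 := fun x hx =>
    Multiplicative.ofAdd.injective (Abelianization.commutator_subset_ker (sndHom D) hx)
  intro x hx y hy
  ext
  · simp [key x hx, key y hy, D.act_zero, add_comm]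
  · simp [add_comm]

/-- The set of `w` with `(0, w)` in `I`. -/
def sndPart (I : AddSubgroup (AsymmetricProduct D)) : AddSubgroup W where
  carrier := {w | (⟨0, w⟩ : AsymmetricProduct D) ∈ I}
  zero_mem' := I.zero_mem
  add_mem' {a b} ha hb := by
    have := I.add_mem ha hb
    rwa [show (⟨0, a⟩ + ⟨0, b⟩ : AsymmetricProduct D) = ⟨0, a + b⟩ by ext <;> simp] at this
  neg_mem' {a} ha := by
    have := I.neg_mem ha
    rwa [show (-⟨0, a⟩ : AsymmetricProduct D) = ⟨0, -a⟩ by ext <;> simp] at this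

theorem mem_sndPart {I : AddSubgroup (AsymmetricProduct D)} {w : W} :
    w ∈ sndPart I ↔ (⟨0, w⟩ : AsymmetricProduct D) ∈ I := Iff.rfl

/-- The map `λ_(v,0)` fixes first coordinates and changes the second by `-form a.fst v`, so this is
`a - λ_(v,0)(a)`. -/
theorem form_mem_sndPart {I : AddSubgroup (AsymmetricProduct D)} (hI : IsLeftIdeal I)
    {a : AsymmetricProduct D} (ha : a ∈ I) (v : V) : D.form a.fst v ∈ sndPart I := by
  have h := I.sub_mem ha (hI ⟨v, 0⟩ a ha)
  rw [mem_sndPart]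
  convert h using 1
  rw [lam, sub_sub_eq_add_sub, eq_sub_iff_add_eq]
  ext
  · simp [D.act_zero, add_comm]
  · simp [D.act_zero, D.form_comm v, add_comm]

/-- The element is the multiplicative commutator of `(0, w)` and `(v, 0)`. -/
theorem act_sub_mem {I : AddSubgroup (AsymmetricProduct D)} (hI : IsIdeal I)
    {w : W} (hw : w ∈ sndPart I) (v : V) :
    (⟨D.act w v - v, 0⟩ : AsymmetricProduct D) ∈ I := by
  obtain ⟨-, N, hN, hNI⟩ := hI
  have hmem : ∀ a, a ∈ N ↔ a ∈ I := fun a => by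
    rw [← SetLike.mem_coe, hNI, SetLike.mem_coe]
  have hg := (hmem _).2 hw
  have := N.mul_mem hg (hN.conj_mem _ (N.inv_mem hg) ⟨v, 0⟩)
  rw [← hmem]
  convert this using 1
  ext
  · simp [D.act_zero, ← D.act_add w (-w), sub_eq_add_neg]
  · simp

/-- The set of `v` with `(v, 0)` in the left ideal `I`. -/
def fstPart {I : AddSubgroup (AsymmetricProduct D)} (hI : IsLeftIdeal I) : AddSubgroup V where
  carrier := {v | (⟨v, 0⟩ : AsymmetricProduct D) ∈ I}
  zero_mem' := I.zero_mem
  add_mem' {a b} ha hb := by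
    -- The cocycle term of the sum lies in `I` itself and can be subtracted.
    have := I.sub_mem (I.add_mem ha hb) (form_mem_sndPart hI ha b)
    rwa [show (⟨a, 0⟩ + ⟨b, 0⟩ - ⟨0, D.form a b⟩ : AsymmetricProduct D) = ⟨a + b, 0⟩ by
      rw [sub_eq_iff_eq_add]; ext <;> simp] at this
  neg_mem' {a} ha := by
    have := I.sub_mem (I.neg_mem ha) (form_mem_sndPart hI ha a)
    rwa [show (-⟨a, 0⟩ - ⟨0, D.form a a⟩ : AsymmetricProduct D) = ⟨-a, 0⟩ by
      rw [sub_eq_iff_eq_add]; ext <;> simp] at this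

theorem eq_top_of_parts {I : AddSubgroup (AsymmetricProduct D)} (hI : IsLeftIdeal I)
    (hV : fstPart hI = ⊤) (hW : sndPart I = ⊤) : I = ⊤ := by
  rw [eq_top_iff]
  intro a _
  have h1 : a.fst ∈ fstPart hI := hV ▸ AddSubgroup.mem_top _
  have h2 : a.snd ∈ sndPart I := hW ▸ AddSubgroup.mem_top _
  have := I.add_mem h1 h2
  rwa [show (⟨a.fst, 0⟩ + ⟨0, a.snd⟩ : AsymmetricProduct D) = a by ext <;> simp] at this

theorem exists_mem_sndPart_ne_zero {I : AddSubgroup (AsymmetricProduct D)} (hI : IsLeftIdeal I)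
    (hform : ∀ v : V, v ≠ 0 → ∃ v', D.form v v' ≠ 0) (hne : I ≠ ⊥) :
    ∃ w ∈ sndPart I, w ≠ 0 := by
  obtain ⟨a, ha, ha0⟩ := I.bot_or_exists_ne_zero.resolve_left hne
  by_cases h : a.fst = 0
  · refine ⟨a.snd, ?_, fun h' => ha0 (AsymmetricProduct.ext h h')⟩
    rw [mem_sndPart, ← h]
    exact ha
  · obtain ⟨v', hv'⟩ := hform _ h
    exact ⟨_, form_mem_sndPart hI ha v', hv'⟩

theorem natCard (D : AsymmetricDatum V W) :
    Nat.card (AsymmetricProduct D) = Nat.card V * Nat.card W := by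
  rw [← Nat.card_prod]
  exact Nat.card_congr ⟨fun a => (a.fst, a.snd), fun a => ⟨a.1, a.2⟩, fun _ => rfl, fun _ => rfl⟩

end AsymmetricProduct

/-! ### Isometry blocks from finite fields -/

/-- A block: a finite abelian group of exponent `q` with a fixed point free action of `ZMod p` that
preserves a nondegenerate symmetric form with values in `ZMod q`. -/
structure IsometryBlock (p q : ℕ) (E : Type*) [AddCommGroup E] where
  act : ZMod p → E →+ E
  act_zero : ∀ e, act 0 e = e
  act_add : ∀ a b e, act (a + b) e = act a (act b e)
  form : E →+ E →+ ZMod q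
  form_comm : ∀ e e', form e e' = form e' e
  form_act : ∀ a e e', form (act a e) (act a e') = form e e'
  exists_form_ne_zero : ∀ e, e ≠ 0 → ∃ e', form e e' ≠ 0
  exists_act_sub_eq : ∀ a, a ≠ 0 → ∀ e, ∃ e', act a e' - e' = e
  nsmul_eq_zero : ∀ e : E, q • e = 0

/-- The number of coordinates of the blocks used. -/
noncomputable def blockDim (p q : ℕ) : ℕ :=
  if p = 2 then 1 else braceNu (orderOf (q : ZMod p)) * orderOf (q : ZMod p)

theorem nsmul_char_eq_zero {q : ℕ} [Fact q.Prime] {F : Type*} [Field F] [Algebra (ZMod q) F]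
    (x : F) : q • x = 0 := by
  have := charP_of_injective_algebraMap (algebraMap (ZMod q) F).injective q
  simp

theorem exists_mul_sub_eq {F : Type*} [Field F] {c : F} (hc : c ≠ 1) (x : F) :
    ∃ y, c * y - y = x :=
  ⟨(c - 1)⁻¹ * x, by have := sub_ne_zero.2 hc; field_simp⟩

theorem zmod_two_eq_one_of_ne_zero : ∀ x : ZMod 2, x ≠ 0 → x = 1 := by decide

section

variable {p q : ℕ} [Fact p.Prime] [Fact q.Prime] {F : Type*} [Field F] [Finite F]
  [Algebra (ZMod q) F]

theorem exists_trace_mul_ne_zero {x : F} (hx : x ≠ 0) :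
    ∃ y, Algebra.trace (ZMod q) F (x * y) ≠ 0 := by
  by_contra! h
  exact hx ((traceForm_nondegenerate (ZMod q) F).1 x h)

/-- The block on a field `F` whose form is `Tr(x σ(y))` for an involution `σ` of `F` inverting
the character through which `ZMod p` acts. -/
noncomputable def IsometryBlock.hermitian (χ : AddChar (ZMod p) F) (hχ : ∀ a, a ≠ 0 → χ a ≠ 1)
    (σ : F ≃ₐ[ZMod q] F) (hσ : ∀ x, σ (σ x) = x) (hσχ : ∀ a, σ (χ a) = (χ a)⁻¹) :
    IsometryBlock p q F where
  act a := AddMonoidHom.mulLeft (χ a)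
  act_zero e := by simp
  act_add a b e := by simp [AddChar.map_add_eq_mul, mul_assoc]
  form := AddMonoidHom.mk' (fun x => AddMonoidHom.mk'
    (fun y => Algebra.trace (ZMod q) F (x * σ y)) fun y y' => by simp [mul_add])
    fun x x' => by ext y; simp [add_mul]
  form_comm x y := by
    simp only [AddMonoidHom.mk'_apply]
    rw [← Algebra.trace_eq_of_algEquiv σ (x * σ y), map_mul, hσ, mul_comm]
  form_act a x y := by
    simp only [AddMonoidHom.mk'_apply, AddMonoidHom.coe_mulLeft, map_mul, hσχ]
    have : χ a ≠ 0 := (AddChar.val_isUnit χ a).ne_zero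
    congr 1
    field_simp
  exists_form_ne_zero x hx := by
    obtain ⟨y, hy⟩ := exists_trace_mul_ne_zero (q := q) hx
    exact ⟨σ y, by simpa [hσ] using hy⟩
  exists_act_sub_eq a ha x := exists_mul_sub_eq (hχ a ha) x
  nsmul_eq_zero := nsmul_char_eq_zero

/-- The hyperbolic block on `F × F`, where `ZMod p` acts through a character and its inverse. -/
noncomputable def IsometryBlock.hyperbolic (χ : AddChar (ZMod p) F)
    (hχ : ∀ a, a ≠ 0 → χ a ≠ 1) : IsometryBlock p q (F × F) where
  act a := (AddMonoidHom.mulLeft (χ a)).prodMap (AddMonoidHom.mulLeft (χ (-a)))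
  act_zero e := by ext <;> simp
  act_add a b e := by
    ext
    · simp [AddChar.map_add_eq_mul, mul_assoc]
    · simp only [neg_add, AddChar.map_add_eq_mul, AddMonoidHom.coe_prodMap, Prod.map,
        AddMonoidHom.coe_mulLeft, mul_assoc]
  form := AddMonoidHom.mk' (fun x => AddMonoidHom.mk'
    (fun y => Algebra.trace (ZMod q) F (x.1 * y.2 + x.2 * y.1))
    fun y y' => by simp [mul_add]; ring)
    fun x x' => by ext y; simp [add_mul]; abel
  form_comm x y := by
    simp only [AddMonoidHom.mk'_apply]
    congr 1
    ring
  form_act a x y := by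
    have : χ a ≠ 0 := (AddChar.val_isUnit χ a).ne_zero
    simp only [AddMonoidHom.mk'_apply, AddMonoidHom.coe_prodMap, Prod.map,
      AddMonoidHom.coe_mulLeft, AddChar.map_neg_eq_inv]
    congr 1
    field_simp
  exists_form_ne_zero x hx := by
    by_cases h : x.1 = 0
    · have h2 : x.2 ≠ 0 := fun h2 => hx (Prod.ext h h2)
      obtain ⟨y, hy⟩ := exists_trace_mul_ne_zero (q := q) h2
      exact ⟨(y, 0), by simpa using hy⟩
    · obtain ⟨y, hy⟩ := exists_trace_mul_ne_zero (q := q) h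
      exact ⟨(0, y), by simpa using hy⟩
  exists_act_sub_eq a ha x := by
    obtain ⟨y, hy⟩ := exists_mul_sub_eq (hχ a ha) x.1
    obtain ⟨y', hy'⟩ := exists_mul_sub_eq (hχ (-a) (neg_ne_zero.2 ha)) x.2
    exact ⟨(y, y'), Prod.ext hy hy'⟩
  nsmul_eq_zero x := Prod.ext (nsmul_char_eq_zero _) (nsmul_char_eq_zero _)

end

theorem natCast_ne_zero_of_prime_ne {p q : ℕ} [Fact p.Prime] [Fact q.Prime] (hpq : p ≠ q) :
    (q : ZMod p) ≠ 0 := by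
  rw [Ne, ZMod.natCast_eq_zero_iff]
  exact fun h => hpq ((Nat.prime_dvd_prime_iff_eq Fact.out Fact.out).1 h)

theorem orderOf_natCast_pos {p q : ℕ} [Fact p.Prime] [Fact q.Prime] (hpq : p ≠ q) :
    0 < orderOf (q : ZMod p) := by
  rw [← Units.val_mk0 (natCast_ne_zero_of_prime_ne hpq), orderOf_units]
  exact orderOf_pos _

/-- Let `ZMod p` act on `F_{q^k}` through a root of unity `ζ` of order `p`. If `k` is even, then
`q^(k/2) = -1` mod `p`, so a power of Frobenius inverts `ζ` and the Hermitian trace form is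
invariant. For `p = 2`, `ζ = -1` is its own inverse and the identity serves. Otherwise pair `F` with
a second copy carrying the inverse character, which doubles the dimension. -/
theorem exists_isometryBlock {p q : ℕ} [Fact p.Prime] [Fact q.Prime] (hpq : p ≠ q) :
    ∃ (E : Type) (_ : AddCommGroup E) (_ : IsometryBlock p q E),
      Nat.card E = q ^ blockDim p q := by
  set k := orderOf (q : ZMod p) with hk
  have hk0 : k ≠ 0 := (orderOf_natCast_pos hpq).ne'
  let F := GaloisField q k
  have hF : Nat.card F = q ^ k := GaloisField.card q k hk0
  let _ : Fintype F := Fintype.ofFinite F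
  let _ : DecidableEq F := Classical.decEq F
  have hqk : (q : ZMod p) ^ k = 1 := pow_orderOf_eq_one _
  have hdvd : p ∣ Fintype.card Fˣ := by
    rw [Fintype.card_units, ← Nat.card_eq_fintype_card, hF, ← ZMod.natCast_eq_zero_iff,
      Nat.cast_sub (Nat.one_le_pow _ _ (Fact.out : q.Prime).pos)]
    simp [hqk]
  obtain ⟨ζ, hζ⟩ := exists_prime_orderOf_dvd_card p hdvd
  have hprim : IsPrimitiveRoot (ζ : F) p := by
    rw [IsPrimitiveRoot.coe_units_iff, ← hζ]
    exact IsPrimitiveRoot.orderOf ζ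
  let χ : AddChar (ZMod p) F := AddChar.zmodChar p hprim.pow_eq_one
  have hχ : ∀ a, a ≠ 0 → χ a ≠ 1 := fun a ha h => by
    have := hprim.dvd_of_pow_eq_one _ h
    exact ha ((ZMod.val_eq_zero a).1 (Nat.eq_zero_of_dvd_of_lt this (ZMod.val_lt a)))
  by_cases hp2 : p = 2
  · have hk1 : k = 1 := by
      subst hp2
      rw [hk, zmod_two_eq_one_of_ne_zero _ (natCast_ne_zero_of_prime_ne hpq), orderOf_one]
    refine ⟨F, inferInstance, .hermitian χ hχ .refl (fun _ => rfl) fun a => ?_, ?_⟩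
    · rw [← AddChar.map_neg_eq_inv]
      subst hp2
      rw [ZMod.neg_eq_self_mod_two]
      rfl
    · rw [hF, blockDim, if_pos hp2, hk1]
  · by_cases hev : Even k
    · obtain ⟨h, hh⟩ := hev
      have hneg : (q : ZMod p) ^ h = -1 := by
        have h1 : (q : ZMod p) ^ h * (q : ZMod p) ^ h = 1 := by rw [← pow_add, ← hh, hqk]
        refine (mul_self_eq_one_iff.1 h1).resolve_left fun h2 => ?_
        have := Nat.le_of_dvd (by omega) (orderOf_dvd_of_pow_eq_one h2)
        omega
      let σ : F ≃ₐ[ZMod q] F := FiniteField.frobeniusAlgEquivOfAlgebraic (ZMod q) F ^ h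
      have hσ : ∀ x, σ x = x ^ q ^ h := fun x => by
        simp [σ, AlgEquiv.coe_pow, FiniteField.coe_frobeniusAlgEquivOfAlgebraic_iterate]
      refine ⟨F, inferInstance, .hermitian χ hχ σ (fun x => ?_) fun a => ?_, ?_⟩
      · rw [hσ, hσ, ← pow_mul, ← pow_add, ← hh, ← hF, Nat.card_eq_fintype_card,
          FiniteField.pow_card]
      · have hz : σ ζ = (ζ : F)⁻¹ := by
          rw [hσ, ← mul_eq_one_iff_eq_inv₀ ζ.ne_zero, ← pow_succ, hprim.pow_eq_one_iff_dvd,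
            ← ZMod.natCast_eq_zero_iff]
          simp [hneg]
        change σ ((ζ : F) ^ a.val) = ((ζ : F) ^ a.val)⁻¹
        rw [map_pow, hz, inv_pow]
      · rw [hF, blockDim, if_neg hp2, braceNu, if_pos ⟨h, hh⟩, one_mul]
    · refine ⟨F × F, inferInstance, .hyperbolic χ hχ, ?_⟩
      rw [Nat.card_prod, hF, blockDim, if_neg hp2, braceNu, if_neg hev, two_mul, pow_add]

theorem eq_zero_of_coprime_nsmul {A : Type*} [AddCommGroup A] {a b : ℕ} (hab : a.Coprime b) {x : A}
    (ha : a • x = 0) (hb : b • x = 0) : x = 0 := by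
  have := Nat.dvd_gcd (addOrderOf_dvd_of_nsmul_eq_zero ha) (addOrderOf_dvd_of_nsmul_eq_zero hb)
  rw [hab.gcd_eq_one, Nat.dvd_one, AddMonoid.addOrderOf_eq_one_iff] at this
  exact this

/-! ### The cyclic datum: Sylow subgroups and simplicity -/

section

variable {n : ℕ} {p : ZMod n → ℕ} [∀ z, Fact (p z).Prime]
  {E W : ZMod n → Type*} [∀ z, AddCommGroup (E z)] [∀ z, AddCommGroup (W z)]
  [∀ z, Module (ZMod (p z)) (W z)] {ι : ZMod n → Type*} [∀ z, Fintype (ι z)]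

/-- The datum in which `W (z - 1)` acts on the blocks `E z` indexed by `ι z` through the
functionals `χ z`, and the forms on these blocks take values in the lines spanned by `ψ z`. -/
def cycleDatum (blk : ∀ z, IsometryBlock (p (z - 1)) (p z) (E z))
    (χ : ∀ z, ι z → W (z - 1) →+ ZMod (p (z - 1))) (ψ : ∀ z, ι z → W z) :
    AsymmetricDatum (∀ z, ι z → E z) (∀ z, W z) where
  act w := AddMonoidHom.mk' (fun v z j => (blk z).act (χ z j (w (z - 1))) (v z j))
    fun v v' => by ext z j; simp
  act_zero v := by ext z j; simp [(blk z).act_zero]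
  act_add w w' v := by ext z j; simp [(blk z).act_add]
  form := AddMonoidHom.mk' (fun v => AddMonoidHom.mk'
    (fun v' z => ∑ j, (blk z).form (v z j) (v' z j) • ψ z j)
    fun v' v'' => by ext z; simp [add_smul, Finset.sum_add_distrib])
    fun v v' => by ext v'' z; simp [add_smul, Finset.sum_add_distrib]
  form_comm v v' := by
    ext z
    exact Finset.sum_congr rfl fun j _ => by rw [(blk z).form_comm]
  form_act w v v' := by
    ext z
    exact Finset.sum_congr rfl fun j _ => by
      simp only [AddMonoidHom.mk'_apply, (blk z).form_act]

variable {blk : ∀ z, IsometryBlock (p (z - 1)) (p z) (E z)}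
  {χ : ∀ z, ι z → W (z - 1) →+ ZMod (p (z - 1))} {ψ : ∀ z, ι z → W z}

theorem cycleDatum_act (w : ∀ z, W z) (v : ∀ z, ι z → E z) (z : ZMod n) (j : ι z) :
    (cycleDatum blk χ ψ).act w v z j = (blk z).act (χ z j (w (z - 1))) (v z j) := rfl

theorem cycleDatum_form (v v' : ∀ z, ι z → E z) (z : ZMod n) :
    (cycleDatum blk χ ψ).form v v' z = ∑ j, (blk z).form (v z j) (v' z j) • ψ z j := rfl

/-- The commutator of two `q`-elements lies in `V`. At `p z = q` it vanishes because both act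
trivially there; elsewhere it is killed by a power of `q` and by `p z`. -/
theorem cycleDatum_hasAbelianSylows (hp : ∀ z, p (z - 1) ≠ p z) :
    HasAbelianSylows (AsymmetricProduct (cycleDatum blk χ ψ)) := by
  intro q hq P
  have hpow : ∀ x ∈ P, ∃ k, x ^ q ^ k = 1 := fun x hx => by
    obtain ⟨k, hk⟩ := P.isPGroup' ⟨x, hx⟩
    exact ⟨k, congrArg Subtype.val hk⟩
  have hcop : ∀ z, p z ≠ q → ∀ k, (q ^ k).Coprime (p z) := fun z hz k =>
    ((Nat.coprime_primes hq Fact.out).2 hz.symm).pow_left k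
  have hsnd : ∀ x ∈ P, ∀ z, p z ≠ q → x.snd z = 0 := fun x hx z hz => by
    obtain ⟨k, hk⟩ := hpow x hx
    refine eq_zero_of_coprime_nsmul (hcop z hz k) ?_ (ZModModule.char_nsmul_eq_zero (p z) _)
    rw [← Pi.smul_apply, ← AsymmetricProduct.snd_pow, hk]
    rfl
  have hact : ∀ x ∈ P, ∀ z, p z = q → ∀ v j,
      (cycleDatum blk χ ψ).act x.snd v z j = v z j := fun x hx z hz v j => by
    rw [cycleDatum_act, hsnd x hx _ (hz ▸ hp z), map_zero, (blk z).act_zero]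
  intro x hx y hy
  rw [← mul_inv_eq_one]
  have hmem : x * y * (y * x)⁻¹ ∈ P := P.mul_mem (P.mul_mem hx hy) (P.inv_mem (P.mul_mem hy hx))
  have hs : (x * y * (y * x)⁻¹).snd = 0 := by simp; abel
  ext1
  · ext z j
    by_cases hz : p z = q
    · have h1 : (x * y).fst z j = (y * x).fst z j := by
        simp [hact x hx z hz, hact y hy z hz, add_comm]
      -- With `c` the commutator, compare first coordinates in `c * (y * x) = x * y`.
      have h2 := congrArg (fun a => a.fst z j) (inv_mul_cancel_right (x * y) (y * x))
      simp only [AsymmetricProduct.fst_mul (x * y * (y * x)⁻¹), hs] at h2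
      rw [Pi.add_apply, Pi.add_apply, AsymmetricDatum.act_zero, ← h1] at h2
      exact add_eq_right.1 h2
    · obtain ⟨k, hk⟩ := hpow _ hmem
      refine eq_zero_of_coprime_nsmul (hcop z hz k) ?_ ((blk z).nsmul_eq_zero _)
      rw [← Pi.smul_apply, ← Pi.smul_apply, ← AsymmetricProduct.fst_pow_of_snd_eq_zero hs, hk]
      rfl
  · exact hs

open AsymmetricProduct LeftBrace

variable [∀ z, DecidableEq (ι z)]

theorem cycleDatum_form_single (z : ZMod n) (j : ι z) (e : E z) (v : ∀ z, ι z → E z) :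
    (cycleDatum blk χ ψ).form (Pi.single z (Pi.single j e)) v =
      Pi.single z ((blk z).form e (v z j) • ψ z j) := by
  ext z'
  rw [cycleDatum_form]
  obtain rfl | hz := eq_or_ne z z'
  · rw [Pi.single_eq_same, Pi.single_eq_same, Finset.sum_eq_single j]
    · simp
    · intro i _ hi
      simp [hi]
    · simp
  · simp [hz.symm]

theorem cycleDatum_act_single (w : ∀ z, W z) (z : ZMod n) (j : ι z) (e : E z) :
    (cycleDatum blk χ ψ).act w (Pi.single z (Pi.single j e)) =
      Pi.single z (Pi.single j ((blk z).act (χ z j (w (z - 1))) e)) := by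
  ext z' i
  rw [cycleDatum_act]
  obtain rfl | hz := eq_or_ne z z'
  · obtain rfl | hi := eq_or_ne j i
    · simp
    · simp [hi.symm]
  · simp [hz.symm]

/-- The distinguished index `j₀` is a hub: every block leads to the block `j₀` at the next `z`, and
that one leads to all blocks after it. -/
theorem cycleDatum_isSimple [NeZero n] [∀ z, Nontrivial (E z)] (j₀ : ∀ z, ι z)
    (hleft : ∀ z j, χ z (j₀ z) (ψ (z - 1) j) ≠ 0)
    (hright : ∀ z i, χ z i (ψ (z - 1) (j₀ (z - 1))) ≠ 0)
    (hχ : ∀ z w, w ≠ 0 → ∃ i, χ z i w ≠ 0)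
    (hψ₀ : ∀ z j, ψ z j ≠ 0)
    (hψ : ∀ z, Submodule.span (ZMod (p z)) (Set.range (ψ z)) = ⊤) :
    IsSimple (AsymmetricProduct (cycleDatum blk χ ψ)) := by
  have hform : ∀ v, v ≠ 0 → ∃ v', (cycleDatum blk χ ψ).form v v' ≠ 0 := fun v hv => by
    obtain ⟨z, hz⟩ := Function.ne_iff.1 hv
    obtain ⟨j, hj⟩ := Function.ne_iff.1 hz
    obtain ⟨e, he⟩ := (blk z).exists_form_ne_zero _ hj
    refine ⟨Pi.single z (Pi.single j e), fun h => ?_⟩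
    rw [AsymmetricDatum.form_comm, cycleDatum_form_single, Pi.single_eq_zero_iff,
      (blk z).form_comm] at h
    exact smul_ne_zero he (hψ₀ z j) h
  refine ⟨?_, fun I hI => or_iff_not_imp_left.2 fun hne => ?_⟩
  · obtain ⟨e, he⟩ := exists_ne (0 : E 0)
    refine ⟨⟨⟨Pi.single 0 (Pi.single (j₀ 0) e), 0⟩, 0, fun h => he ?_⟩⟩
    simpa using congrArg AsymmetricProduct.fst h
  let S (z : ZMod n) (j : ι z) : Prop := ∀ e, Pi.single z (Pi.single j e) ∈ fstPart hI.1
  have hS_of_snd : ∀ z i w, w ∈ sndPart I → χ z i (w (z - 1)) ≠ 0 → S z i :=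
    fun z i w hw hne e => by
      obtain ⟨e', he'⟩ := (blk z).exists_act_sub_eq _ hne e
      have := act_sub_mem hI hw (Pi.single z (Pi.single i e'))
      rwa [cycleDatum_act_single, ← Pi.single_sub, ← Pi.single_sub, he'] at this
  have hψ_of_S : ∀ z j, S z j → Pi.single z (ψ z j) ∈ sndPart I := fun z j h => by
    obtain ⟨e, he⟩ := exists_ne (0 : E z)
    obtain ⟨e', he'⟩ := (blk z).exists_form_ne_zero e he
    have h1 := form_mem_sndPart hI.1 (h e) (Pi.single z (Pi.single j e'))
    rw [cycleDatum_form_single, Pi.single_eq_same, Pi.single_eq_same] at h1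
    let K := (sndPart I).comap (AddMonoidHom.single W z)
    have h2 : (blk z).form e e' • ψ z j ∈ K := h1
    -- An additive subgroup of `W z` is a subspace over the prime field, so the nonzero scalar can
    -- be divided out.
    have h3 := ZMod.smul_mem h2 ((blk z).form e e')⁻¹
    rwa [inv_smul_smul₀ he'] at h3
  have hstep : ∀ z j i, S (z - 1) j → χ z i (ψ (z - 1) j) ≠ 0 → S z i :=
    fun z j i h hne => hS_of_snd z i _ (hψ_of_S _ j h) (by rwa [Pi.single_eq_same])
  obtain ⟨w, hw, hw0⟩ := exists_mem_sndPart_ne_zero hI.1 hform hne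
  obtain ⟨z₀, hz₀⟩ := Function.ne_iff.1 hw0
  obtain ⟨z, rfl⟩ : ∃ z, z₀ = z - 1 := ⟨z₀ + 1, by ring⟩
  obtain ⟨i, hi⟩ := hχ z _ hz₀
  have hnat : ∀ k : ℕ, ∃ j, S (z + k) j := fun k => by
    induction k with
    | zero =>
      rw [Nat.cast_zero, add_zero]
      exact ⟨i, hS_of_snd z i w hw hi⟩
    | succ k ih =>
      rw [← add_sub_cancel_right (z + (k : ZMod n)) 1] at ih
      obtain ⟨j, hj⟩ := ih
      rw [Nat.cast_succ, ← add_assoc]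
      exact ⟨_, hstep _ j _ hj (hleft _ j)⟩
  have hex : ∀ z', ∃ j, S z' j := fun z' => by
    rw [show z' = z + ((z' - z).val : ℕ) by simp]
    exact hnat _
  have hall : ∀ z j, S z j := fun z j => by
    -- Start two places back: one step enters the hub, the second fans out to every `j`.
    obtain ⟨i, hi⟩ := hex (z - 1 - 1)
    exact hstep z _ j (hstep _ i _ hi (hleft _ i)) (hright z j)
  refine eq_top_of_parts hI.1 ?_ ?_
  · rw [eq_top_iff]
    intro v _
    rw [← Finset.univ_sum_single v]
    refine sum_mem fun z _ => ?_
    rw [← Finset.univ_sum_single (v z)]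
    change AddMonoidHom.single _ z _ ∈ _
    rw [map_sum]
    exact sum_mem fun j _ => hall z j _
  · rw [eq_top_iff]
    intro w _
    rw [← Finset.univ_sum_single w]
    refine sum_mem fun z _ => ?_
    let K := AddSubgroup.toZModSubmodule (p z) ((sndPart I).comap (AddMonoidHom.single W z))
    have h1 : Submodule.span (ZMod (p z)) (Set.range (ψ z)) ≤ K :=
      Submodule.span_le.2 (Set.range_subset_iff.2 fun j => hψ_of_S z j (hall z j))
    have h2 : w z ∈ K := h1 (hψ z ▸ Submodule.mem_top)
    exact h2

end

/-! ### Star vectors: spanning families and separating functionals with a hub -/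

section

variable {R : Type*} [CommRing R] {s : ℕ} [NeZero s]

/-- The vector `e₀ + e_j`, and `e₀` if `j` is zero or out of range. -/
def starVector (R : Type*) [CommRing R] (s : ℕ) [NeZero s] (j : ℕ) : Fin s → R :=
  fun i => if i = 0 ∨ (i : ℕ) = j then 1 else 0

/-- The functional dual to `starVector`. -/
def starFunctional (R : Type*) [CommRing R] (s : ℕ) [NeZero s] (j : ℕ) : (Fin s → R) →+ R where
  toFun w := ∑ i, starVector R s j i * w i
  map_zero' := by simp
  map_add' w w' := by simp [mul_add, Finset.sum_add_distrib]

theorem starVector_zero : starVector R s 0 = Pi.single 0 1 := by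
  ext i
  simp [starVector, Pi.single_apply]

theorem starVector_eq_add {i : Fin s} (hi : i ≠ 0) :
    starVector R s i = Pi.single 0 1 + Pi.single i 1 := by
  ext k
  by_cases hk : k = 0
  · simp [starVector, hk, hi.symm]
  · simp [starVector, hk, Pi.single_apply, Fin.ext_iff]

theorem starFunctional_zero_apply (w : Fin s → R) : starFunctional R s 0 w = w 0 := by
  simp [starFunctional, starVector_zero, Pi.single_apply]

theorem starFunctional_apply_of_ne {i : Fin s} (hi : i ≠ 0) (w : Fin s → R) :
    starFunctional R s i w = w 0 + w i := by
  simp [starFunctional, starVector_eq_add hi, Pi.single_apply, add_mul, Finset.sum_add_distrib]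

/-- All star vectors share the coordinate `0` with entry `1`, so pairing with `e₀` gives `1` in
every characteristic, also for out-of-range indices. -/
theorem starFunctional_zero_starVector (j : ℕ) :
    starFunctional R s 0 (starVector R s j) = 1 := by
  simp [starFunctional_zero_apply, starVector]

theorem starFunctional_starVector_zero (j : ℕ) :
    starFunctional R s j (starVector R s 0) = 1 := by
  rw [starVector_zero]
  change ∑ i, starVector R s j i * Pi.single (M := fun _ => R) 0 1 i = 1
  rw [Finset.sum_eq_single 0 (fun i _ hi => by simp [hi]) (by simp)]
  simp [starVector]

theorem starVector_ne_zero [Nontrivial R] (j : ℕ) : starVector R s j ≠ 0 := fun h => by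
  simpa [starVector] using congrFun h 0

theorem exists_starFunctional_ne_zero {r : ℕ} (hr : s ≤ r) {w : Fin s → R} (hw : w ≠ 0) :
    ∃ i : Fin r, starFunctional R s i w ≠ 0 := by
  by_contra! h
  have h0 : w 0 = 0 := by
    rw [← starFunctional_zero_apply w]
    exact h ⟨0, (NeZero.pos s).trans_le hr⟩
  refine hw (funext fun i => ?_)
  by_cases hi : i = 0
  · rw [hi, h0]; rfl
  · have := h (i.castLE hr)
    rwa [Fin.val_castLE, starFunctional_apply_of_ne hi, h0, zero_add] at this

theorem span_starVector {r : ℕ} (hr : s ≤ r) :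
    Submodule.span R (Set.range fun j : Fin r => starVector R s j) = ⊤ := by
  have hmem : ∀ i : Fin s, starVector R s i ∈
      Submodule.span R (Set.range fun j : Fin r => starVector R s j) := fun i =>
    Submodule.subset_span ⟨i.castLE hr, rfl⟩
  have h0 := hmem 0
  rw [Fin.val_zero, starVector_zero] at h0
  rw [eq_top_iff, ← (Pi.basisFun R (Fin s)).span_eq, Submodule.span_le]
  rintro _ ⟨i, rfl⟩
  rw [Pi.basisFun_apply]
  by_cases hi : i = 0
  · rwa [hi]
  · have := Submodule.sub_mem _ (hmem i) h0
    rwa [starVector_eq_add hi, add_sub_cancel_left] at this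

end

/-! ### Choice of the exponents and assembly -/

theorem braceNu_pos (k : ℕ) : 0 < braceNu k := by
  rw [braceNu]
  split_ifs <;> norm_num

theorem blockDim_pos {p q : ℕ} [Fact p.Prime] [Fact q.Prime] (hpq : p ≠ q) :
    0 < blockDim p q := by
  rw [blockDim]
  split_ifs
  · exact one_pos
  · exact Nat.mul_pos (braceNu_pos _) (orderOf_natCast_pos hpq)

/-- A number that is large enough can be written as `D * r + s` with `s` in a prescribed complete
system of positive residues and `r` large. -/
theorem exists_mul_add_eq {D R m : ℕ} (hD : 0 < D) (hDR : D ≤ R) (hm : R * (D + 1) ≤ m) :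
    ∃ r s, D * r + s = m ∧ 0 < s ∧ s ≤ D ∧ R ≤ r := by
  have hm0 : 0 < m := lt_of_lt_of_le (by positivity [hD.trans_le hDR]) hm
  -- Dividing `m - 1` instead of `m` puts `s` in `1, …, D`, so `s` is never zero.
  refine ⟨(m - 1) / D, (m - 1) % D + 1, ?_, by omega, Nat.mod_lt _ hD, ?_⟩
  · have := Nat.div_add_mod (m - 1) D
    omega
  · rw [Nat.le_div_iff_mul_le hD]
    rw [mul_add] at hm
    omega

theorem exists_mul_add_eq_of_braceBound_le {n : ℕ} {p : ZMod n → ℕ} [∀ z, Fact (p z).Prime]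
    (hp : ∀ z, p (z - 1) ≠ p z) (z : ZMod n) {m : ℕ} (hm : braceBound p z ≤ m) :
    ∃ r s, blockDim (p (z - 1)) (p z) * r + s = m ∧ 0 < s ∧ s ≤ r ∧
      s ≤ braceNu (braceOrd p z) * braceOrd p z ∧
      braceNu (braceOrd p (z - 1)) * braceOrd p (z - 1) ≤ r := by
  have hpos : ∀ z, 0 < braceNu (braceOrd p z) * braceOrd p z := fun z =>
    Nat.mul_pos (braceNu_pos _) (orderOf_natCast_pos (hp z))
  have h1 := hpos z
  have h2 := hpos (z - 1)
  rw [braceBound] at hm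
  split_ifs at hm with h
  · refine ⟨m - 1, 1, ?_, one_pos, ?_, h1, ?_⟩
    · rw [blockDim, if_pos h]; omega
    all_goals omega
  · obtain ⟨r, s, hrs, hs, hsD, hr⟩ := exists_mul_add_eq h1 (le_max_left _ _) hm
    refine ⟨r, s, ?_, hs, ?_, hsD, (le_max_right _ _).trans hr⟩
    · rw [blockDim, if_neg h]; exact hrs
    · exact hsD.trans ((le_max_left _ _).trans hr)

theorem mainTheorem3 (n : ℕ) [NeZero n] (hn : 1 < n) (p : ZMod n → ℕ)
    (hp : ∀ z, (p z).Prime) (hinj : ∀ z z', z ≠ z' → p z ≠ p z')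
    (m : ZMod n → ℕ) (hm : ∀ z, braceBound p z ≤ m z) :
    ∃ (B : Type) (_ : LeftBrace B),
      Nat.card B = ∏ z : ZMod n, p z ^ m z ∧
      LeftBrace.IsSimple B ∧ IsMetabelianGroup B ∧ HasAbelianSylows B := by
  have : Fact (1 < n) := ⟨hn⟩
  have : ∀ z, Fact (p z).Prime := fun z => ⟨hp z⟩
  have hpz : ∀ z, p (z - 1) ≠ p z := fun z => hinj _ _ (by simp)
  choose r s hrs hs hsr hsK hr using fun z => exists_mul_add_eq_of_braceBound_le hpz z (hm z)
  choose E instE blk hE using fun z => exists_isometryBlock (hpz z)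
  have : ∀ z, NeZero (s z) := fun z => ⟨(hs z).ne'⟩
  have hsr' : ∀ z, s (z - 1) ≤ r z := fun z => (hsK (z - 1)).trans (hr z)
  have : ∀ z, Nontrivial (E z) := fun z => by
    have : Finite (E z) := Nat.finite_of_card_ne_zero (by
      rw [hE]; exact pow_ne_zero _ (hp z).ne_zero)
    rw [← Finite.one_lt_card_iff_nontrivial, hE]
    exact Nat.one_lt_pow (blockDim_pos (hpz z)).ne' (hp z).one_lt
  let D := cycleDatum (ι := fun z => Fin (r z)) (W := fun z => Fin (s z) → ZMod (p z)) blk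
    (fun z j => starFunctional _ _ j) (fun z j => starVector _ _ j)
  refine ⟨AsymmetricProduct D, inferInstance, ?_, ?_, AsymmetricProduct.isMetabelianGroup D,
    cycleDatum_hasAbelianSylows hpz⟩
  · rw [AsymmetricProduct.natCard, Nat.card_pi, Nat.card_pi, ← Finset.prod_mul_distrib]
    refine Finset.prod_congr rfl fun z _ => ?_
    rw [Nat.card_fun, Nat.card_fun, hE, Nat.card_zmod, Nat.card_fin, Nat.card_fin, ← pow_mul,
      ← pow_add, hrs]
  · refine cycleDatum_isSimple (fun z => ⟨0, (hs z).trans_le (hsr z)⟩) (fun z j => ?_)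
      (fun z i => ?_) (fun z w hw => exists_starFunctional_ne_zero (hsr' z) hw)
      (fun z j => starVector_ne_zero _) fun z => span_starVector (hsr z)
    · rw [starFunctional_zero_starVector]
      exact one_ne_zero
    · rw [starFunctional_starVector_zero]
      exact one_ne_zero
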